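/- Let $G$ be a nonabelian finite group. Write $\operatorname{Irr}(G)$ for the set of irreducible complex characters of $G$ and, for $\chi\in\operatorname{Irr}(G)$, put $\ker\chi=\{g\in G: \chi(g)=\chi(1)\}$ and $Z(\chi)=\{g\in G: |\chi(g)|=\chi(1)\}$. A group is called monolithic if it has a unique minimal normal subgroup (a minimal element among its nontrivial normal subgroups), and $\chi\in\operatorname{Irr}(G)$ is called monolithic if the quotient group $G/\ker\chi$ is monolithic. Write $[g,x]$ for the commutator of $g,x\in G$ and $[g,G]$ for the subgroup generated by all $[g,x]$ with $x\in G$. The following are equivalent: 1. $G$ is a GVZ-group, that is, for every $\chi\in\operatorname{Irr}(G)$ and every $g\in G\setminus Z(\chi)$ one has $\chi(g)=0$. 2. For every monolithic character $\chi\in\operatorname{Irr}(G)$ and every $g\in G\setminus Z(\chi)$, there exists $x\in G$ such that $[g,x]\in Z(\chi)\setminus\ker\chi$. 3. $G$ is nilpotent, and for every normal subgroup $N$ of $G$ for which $G/N$ is monolithic and every $g\in G$ with $[g,G]\nleq N$, there exists $x\in G$ such that $[g,x]\notin N$ and $[[g,x],G]\le N$. -/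

import Mathlib

open scoped commutatorElement

/-- `Irr(G)`: the set of (complex) irreducible characters of `G`, as functions `G → ℂ`. Every
finite-dimensional complex representation is isomorphic to one on some `ℂⁿ`. -/
def Irr (G : Type*) [Group G] : Set (G → ℂ) :=
  {χ | ∃ (n : ℕ) (ρ : Representation ℂ G (Fin n → ℂ)), ρ.IsIrreducible ∧ ρ.character = χ}

/-- An endomorphism of finite order whose trace is the dimension is the identity. -/
theorem end_eq_one_of_pow_eq_one_of_trace {V : Type*} [AddCommGroup V] [Module ℂ V]
    [FiniteDimensional ℂ V] (f : Module.End ℂ V) {m : ℕ} (hm : m ≠ 0) (hf : f ^ m = 1)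
    (ht : LinearMap.trace ℂ V f = Module.finrank ℂ V) : f = 1 := by
  have hss : f.IsSemisimple := by
    refine Module.End.isSemisimple_of_squarefree_aeval_eq_zero
      (p := (Polynomial.X ^ m - 1 : Polynomial ℂ)) ?_ (by simp [hf])
    exact (Polynomial.X_pow_sub_one_separable_iff.mpr (by exact_mod_cast hm)).squarefree
  have hpow : ∀ μ : ℂ, f.HasEigenvalue μ → μ ^ m = 1 := by
    intro μ hμ
    obtain ⟨v, hv⟩ := hμ.exists_hasEigenvector
    have h1 := hv.pow_apply m
    rw [hf] at h1
    have h2 : (μ ^ m - 1) • v = 0 := by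
      rw [sub_smul, ← h1]; simp
    exact sub_eq_zero.mp ((smul_eq_zero.mp h2).resolve_right hv.2)
  have hspl : f.charpoly.Splits := IsAlgClosed.splits _
  have hcard : f.charpoly.roots.card = Module.finrank ℂ V := by
    rw [IsAlgClosed.card_roots_eq_natDegree, LinearMap.charpoly_natDegree]
  have hroot : ∀ μ ∈ f.charpoly.roots, ‖μ‖ = 1 := by
    intro μ hμ
    exact Complex.norm_eq_one_of_pow_eq_one
      (hpow μ (Module.End.hasEigenvalue_iff_isRoot_charpoly f μ |>.mpr
        (Polynomial.isRoot_of_mem_roots hμ))) hm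
  have hone : ∀ μ ∈ f.charpoly.roots, μ = 1 := by
    have hsum : (f.charpoly.roots.map fun μ => 1 - μ.re).sum = 0 := by
      have h1 : (f.charpoly.roots.map fun μ => μ.re).sum = (f.charpoly.roots.sum).re := by
        exact (map_multiset_sum Complex.reAddGroupHom f.charpoly.roots).symm
      have h2 := Module.End.trace_eq_sum_roots_charpoly_of_splits hspl
      rw [Multiset.sum_map_sub, h1, ← h2, ht]
      simp [hcard]
    have h0 := Multiset.all_zero_of_le_zero_le_of_sum_eq_zero (s := f.charpoly.roots.map _)
      (by
        intro x hx
        obtain ⟨μ, hμ, rfl⟩ := Multiset.mem_map.mp hx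
        have := Complex.re_le_norm μ
        rw [hroot μ hμ] at this
        linarith) hsum
    intro μ hμ
    have h3 : μ.re = 1 := by
      have := h0 _ (Multiset.mem_map_of_mem _ hμ)
      linarith
    have h4 := Complex.sq_norm μ
    rw [hroot μ hμ, Complex.normSq_apply, h3] at h4
    have h5 : μ.im = 0 := by nlinarith
    exact Complex.ext (by simpa using h3) (by simpa using h5)
  have htop : f.eigenspace 1 = ⊤ := by
    rw [← hss.iSup_eigenspace_eq_top]
    refine le_antisymm (le_iSup _ 1) (iSup_le fun μ => ?_)
    by_cases hμ : f.HasEigenvalue μ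
    · rw [hone μ ((Polynomial.mem_roots f.charpoly_monic.ne_zero).mpr
        ((Module.End.hasEigenvalue_iff_isRoot_charpoly f μ).mp hμ))]
    · have : f.eigenspace μ = ⊥ := by
        simpa [Module.End.hasEigenvalue_iff] using hμ
      simp [this]
  ext v
  have : v ∈ f.eigenspace 1 := htop ▸ Submodule.mem_top
  simpa using Module.End.mem_eigenspace_iff.mp this

/-- The set `{g | χ(g) = χ(1)}` is the kernel of any representation affording `χ`. -/
theorem character_eq_character_one_iff {G : Type*} [Group G] [Finite G] {n : ℕ}
    (ρ : Representation ℂ G (Fin n → ℂ)) (g : G) :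
    ρ.character g = ρ.character 1 ↔ ρ g = 1 := by
  constructor
  · intro h
    refine end_eq_one_of_pow_eq_one_of_trace (ρ g) (m := orderOf g) (orderOf_pos g).ne' ?_ ?_
    · rw [← map_pow, pow_orderOf_eq_one, map_one]
    · rw [Representation.char_one] at h
      exact h
  · intro h
    simp [Representation.character, h]

/-- `ker χ = {g | χ(g) = χ(1)}`, a subgroup of `G`. -/
def charKernel {G : Type*} [Group G] [Finite G] {χ : G → ℂ} (hχ : χ ∈ Irr G) : Subgroup G where
  carrier := {g | χ g = χ 1}
  one_mem' := rfl
  mul_mem' := by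
    obtain ⟨n, ρ, -, rfl⟩ := hχ
    intro a b ha hb
    simp only [Set.mem_ofPred_eq, character_eq_character_one_iff, map_mul] at *
    simp [ha, hb]
  inv_mem' := by
    obtain ⟨n, ρ, -, rfl⟩ := hχ
    intro a ha
    simp only [Set.mem_ofPred_eq, character_eq_character_one_iff] at *
    have h : ρ (a⁻¹ * a) = 1 := by simp
    rwa [map_mul, ha, mul_one] at h

/-- The kernel of an irreducible character is normal. -/
instance charKernel_normal {G : Type*} [Group G] [Finite G] {χ : G → ℂ} (hχ : χ ∈ Irr G) :
    (charKernel hχ).Normal where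
  conj_mem := by
    intro a ha g
    obtain ⟨n, ρ, hρ, rfl⟩ := hχ
    change ρ.character a = ρ.character 1 at ha
    change ρ.character (g * a * g⁻¹) = ρ.character 1
    rw [Representation.char_conj, ha]

/-- The center `Z(χ) = {g | |χ(g)| = χ(1)}` of a character `χ`. -/
def charCenter {G : Type*} [Group G] (χ : G → ℂ) : Set G :=
  {g | (‖χ g‖ : ℂ) = χ 1}

/-- `G` is a GVZ-group: every irreducible character vanishes off its center. -/
def IsGVZGroup (G : Type*) [Group G] : Prop :=
  ∀ χ ∈ Irr G, ∀ g : G, g ∉ charCenter χ → χ g = 0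

/-- `G` is monolithic: it has a unique minimal normal subgroup, i.e. a unique minimal element
among the nontrivial normal subgroups. -/
def IsMonolithic (G : Type*) [Group G] : Prop :=
  ∃! M : Subgroup G, Minimal (fun K : Subgroup G => K.Normal ∧ K ≠ ⊥) M

/-- An irreducible character `χ` of `G` is monolithic if `G / ker χ` is a monolithic group. -/
def IsMonolithicCharacter {G : Type*} [Group G] [Finite G] {χ : G → ℂ} (hχ : χ ∈ Irr G) : Prop :=
  IsMonolithic (G ⧸ charKernel hχ)

/-- `[g, G]`: the subgroup generated by the commutators `[g, x]` with `x ∈ G`. -/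
def elementCommutator {G : Type*} [Group G] (g : G) : Subgroup G :=
  Subgroup.closure (Set.range fun x : G => ⁅g, x⁆)

/-! By Schur's lemma `Z(χ)/ker χ` is the center of `G/ker χ`, so `g ∈ Z(χ)` means `[g, G] ≤ ker χ`.
A monolithic group has a faithful irreducible character, so conditions 2 and 3 both say that
monolithic quotients have central commutators. This property alone gives nilpotency, by induction on
the order.

For 1 → 3, comparing the class sum of `g` with the coset sum of `[g, G]g` in the group algebra shows
that a GVZ-group is flat: every element of `[g, G]` is some `[g, x]`. Flatness passes to quotients
and forces a nontrivial center. In a monolithic quotient the socle is thus central, and it lies in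
`[g, G]` for noncentral `g`, so it supplies the required commutator.

For 3 → 1, `G/ker χ` need not be monolithic, but it is nilpotent with cyclic center. Its Sylow
factors are `p`-groups with cyclic center, hence monolithic or trivial, and a central commutator in
one factor is central in the product. If `[g, x]` acts as a scalar `c ≠ 1`, then `χ(g) = c χ(g)`, so
`χ(g) = 0`. -/

/-! ### The subgroups `[g, G]` -/

theorem elementCommutator_le_iff {G : Type*} [Group G] {g : G} {N : Subgroup G} :
    elementCommutator g ≤ N ↔ ∀ x : G, ⁅g, x⁆ ∈ N := by
  rw [elementCommutator, Subgroup.closure_le, Set.range_subset_iff]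
  rfl

theorem commutatorElement_mem_elementCommutator {G : Type*} [Group G] (g x : G) :
    ⁅g, x⁆ ∈ elementCommutator g :=
  elementCommutator_le_iff.mp le_rfl x

theorem mem_center_iff_commutatorElement_eq_one {G : Type*} [Group G] {g : G} :
    g ∈ Subgroup.center G ↔ ∀ x : G, ⁅g, x⁆ = 1 := by
  simp only [Subgroup.mem_center_iff, commutatorElement_eq_one_iff_mul_comm, eq_comm]

/-- `[g, G] ≤ N` means that `g` is central modulo `N`. -/
theorem elementCommutator_le_ker_iff {G H : Type*} [Group G] [Group H] (f : G →* H)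
    (hf : Function.Surjective f) {g : G} :
    elementCommutator g ≤ f.ker ↔ f g ∈ Subgroup.center H := by
  rw [elementCommutator_le_iff, mem_center_iff_commutatorElement_eq_one, hf.forall]
  simp only [MonoidHom.mem_ker, map_commutatorElement]

instance elementCommutator_normal {G : Type*} [Group G] (g : G) :
    (elementCommutator g).Normal where
  conj_mem := by
    intro a ha y
    induction ha using Subgroup.closure_induction with
    | mem a ha =>
      obtain ⟨x, rfl⟩ := ha
      have h : y * ⁅g, x⁆ * y⁻¹ = ⁅g, y⁆⁻¹ * ⁅g, y * x⁆ := by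
        simp only [commutatorElement_def]; group
      change y * ⁅g, x⁆ * y⁻¹ ∈ _
      rw [h]
      exact mul_mem (inv_mem (commutatorElement_mem_elementCommutator _ _))
        (commutatorElement_mem_elementCommutator _ _)
    | one => simp
    | mul a b _ _ ha hb =>
      rw [show y * (a * b) * y⁻¹ = (y * a * y⁻¹) * (y * b * y⁻¹) by group]
      exact mul_mem ha hb
    | inv a _ ha =>
      rw [show y * a⁻¹ * y⁻¹ = (y * a * y⁻¹)⁻¹ by group]
      exact inv_mem ha

theorem map_elementCommutator {G H : Type*} [Group G] [Group H] (f : G →* H)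
    (hf : Function.Surjective f) (g : G) :
    (elementCommutator g).map f = elementCommutator (f g) := by
  rw [elementCommutator, MonoidHom.map_closure, elementCommutator, ← Set.range_comp]
  congr 1
  have h : (f ∘ fun x : G => ⁅g, x⁆) = (fun y : H => ⁅f g, y⁆) ∘ f := by
    ext x; simp [map_commutatorElement]
  rw [h, hf.range_comp]

/-! ### Minimal normal subgroups and monolithic groups -/

theorem exists_minimal_normal_le {G : Type*} [Group G] [Finite G] {K : Subgroup G}
    (hK : K.Normal) (hK' : K ≠ ⊥) :
    ∃ M ≤ K, Minimal (fun L : Subgroup G => L.Normal ∧ L ≠ ⊥) M :=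
  exists_minimal_le_of_wellFoundedLT _ K ⟨hK, hK'⟩

theorem minimal_normal_le_of_inf_ne_bot {G : Type*} [Group G] {M K : Subgroup G}
    (hM : Minimal (fun L : Subgroup G => L.Normal ∧ L ≠ ⊥) M) (hK : K.Normal) (h : M ⊓ K ≠ ⊥) :
    M ≤ K :=
  have := hM.prop.1
  (hM.le_of_le ⟨inferInstance, h⟩ inf_le_left).trans inf_le_right

theorem IsMonolithic.exists_le {G : Type*} [Group G] [Finite G] (h : IsMonolithic G) :
    ∃ M : Subgroup G, M.Normal ∧ M ≠ ⊥ ∧ ∀ K : Subgroup G, K.Normal → K ≠ ⊥ → M ≤ K := by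
  obtain ⟨M, hM, hu⟩ := h
  refine ⟨M, hM.prop.1, hM.prop.2, fun K hK hK' => ?_⟩
  obtain ⟨L, hLK, hL⟩ := exists_minimal_normal_le hK hK'
  exact hu L hL ▸ hLK

theorem minimal_normal_mapSubgroup {G H : Type*} [Group G] [Group H] (e : G ≃* H)
    {M : Subgroup G} (hM : Minimal (fun L : Subgroup G => L.Normal ∧ L ≠ ⊥) M) :
    Minimal (fun L : Subgroup H => L.Normal ∧ L ≠ ⊥) (e.mapSubgroup M) := by
  refine ⟨⟨hM.prop.1.map _ e.surjective, fun h => hM.prop.2 ((map_eq_bot_iff e.mapSubgroup).mp h)⟩,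
    fun L hL hLM => ?_⟩
  have h1 := hM.le_of_le (y := e.mapSubgroup.symm L)
    ⟨hL.1.map e.symm.toMonoidHom e.symm.surjective,
      fun h => hL.2 ((map_eq_bot_iff e.mapSubgroup.symm).mp h)⟩
    (by rwa [OrderIso.symm_apply_le])
  rwa [OrderIso.le_symm_apply] at h1

theorem IsMonolithic.of_mulEquiv {G H : Type*} [Group G] [Group H] (e : G ≃* H)
    (h : IsMonolithic G) : IsMonolithic H := by
  obtain ⟨M, hM, hu⟩ := h
  refine ⟨e.mapSubgroup M, minimal_normal_mapSubgroup e hM, fun L hL => ?_⟩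
  have h1 : e.mapSubgroup.symm L = M := hu _ (minimal_normal_mapSubgroup e.symm hL)
  rw [← h1, OrderIso.apply_symm_apply]

theorem card_quotient_lt {G : Type*} [Group G] [Finite G] {N : Subgroup G} (hN : N ≠ ⊥) :
    Nat.card (G ⧸ N) < Nat.card G := by
  rw [Subgroup.card_eq_card_quotient_mul_card_subgroup N]
  exact lt_mul_of_one_lt_right Nat.card_pos (N.one_lt_card_iff_ne_bot.mpr hN)

theorem isNilpotent_of_injective {G H : Type*} [Group G] [Group H] [Group.IsNilpotent H]
    (f : G →* H) (hf : Function.Injective f) : Group.IsNilpotent G :=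
  Subgroup.isNilpotent_of_ker_le_center f (by simp [(MonoidHom.ker_eq_bot_iff f).mpr hf])

/-- If all proper quotients are nilpotent, it is enough to find central elements in the
monolithic case. -/
theorem isNilpotent_of_quotient_of_monolithic {G : Type*} [Group G] [Finite G]
    (hq : ∀ (N : Subgroup G) [N.Normal], N ≠ ⊥ → Group.IsNilpotent (G ⧸ N))
    (hm : IsMonolithic G → Subgroup.center G ≠ ⊥) : Group.IsNilpotent G := by
  rcases subsingleton_or_nontrivial G with hs | hn
  · infer_instance
  by_cases hG : IsMonolithic G
  · exact Group.of_quotient_center_nilpotent (hq _ (hm hG))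
  -- Two distinct minimal normal subgroups meet trivially, so `G` embeds in the product of two
  -- nilpotent quotients.
  obtain ⟨M, -, hM⟩ := exists_minimal_normal_le (G := G) (K := ⊤) inferInstance top_ne_bot
  obtain ⟨L, hL, hLM⟩ : ∃ L, Minimal (fun L : Subgroup G => L.Normal ∧ L ≠ ⊥) L ∧ L ≠ M := by
    by_contra! h
    exact hG ⟨M, hM, h⟩
  have := hM.prop.1
  have := hL.prop.1
  have h1 : M ⊓ L = ⊥ := by
    by_contra h
    have h2 := minimal_normal_le_of_inf_ne_bot hM hL.prop.1 h
    have h3 := minimal_normal_le_of_inf_ne_bot hL hM.prop.1 (by rwa [inf_comm])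
    exact hLM (le_antisymm h3 h2)
  have := hq M hM.prop.2
  have := hq L hL.prop.2
  refine isNilpotent_of_injective ((QuotientGroup.mk' M).prod (QuotientGroup.mk' L)) ?_
  rw [← MonoidHom.ker_eq_bot_iff, MonoidHom.ker_prod]
  simpa using h1

/-! ### Groups in which every element of `g[g, G]` is conjugate to `g` -/

/-- Every element of `[g, G]` is a commutator `[g, x]`, for all `g`. -/
def IsFlatGroup (G : Type*) [Group G] : Prop :=
  ∀ g : G, ∀ h ∈ elementCommutator g, ∃ x : G, ⁅g, x⁆ = h

theorem IsFlatGroup.of_surjective {G H : Type*} [Group G] [Group H] (h : IsFlatGroup G)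
    (f : G →* H) (hf : Function.Surjective f) : IsFlatGroup H := by
  intro g z hz
  obtain ⟨g, rfl⟩ := hf g
  rw [← map_elementCommutator f hf] at hz
  obtain ⟨w, hw, rfl⟩ := hz
  obtain ⟨x, rfl⟩ := h g w hw
  exact ⟨f x, (map_commutatorElement f g x).symm⟩

/-- With trivial center, any `g ≠ 1` in a minimal normal subgroup `M` has `[g, G] = M`, so flatness
would make `g` itself of the form `[g, x]`, which forces `g = 1`. -/
theorem IsFlatGroup.center_ne_bot {G : Type*} [Group G] [Finite G] [Nontrivial G]
    (h : IsFlatGroup G) : Subgroup.center G ≠ ⊥ := by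
  intro hc
  obtain ⟨M, -, hM⟩ := exists_minimal_normal_le (G := G) (K := ⊤) inferInstance top_ne_bot
  obtain ⟨hMn, hMb⟩ := hM.prop
  obtain ⟨g, hg, hg1⟩ := M.bot_or_exists_ne_one.resolve_left hMb
  have hle : elementCommutator g ≤ M := elementCommutator_le_iff.mpr fun x => by
    rw [commutatorElement_def, mul_assoc g x, mul_assoc]
    exact mul_mem hg (hMn.conj_mem _ (inv_mem hg) x)
  have hne : elementCommutator g ≠ ⊥ := by
    intro h0
    have h1 : g ∈ Subgroup.center G := mem_center_iff_commutatorElement_eq_one.mpr fun x => by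
      simpa [h0] using commutatorElement_mem_elementCommutator g x
    exact hg1 (by simpa [hc] using h1)
  have hge := hM.le_of_le ⟨inferInstance, hne⟩ hle
  obtain ⟨x, hx⟩ := h g g (hge hg)
  rw [commutatorElement_def, mul_assoc, mul_assoc, mul_eq_left] at hx
  apply hg1
  have : x * g⁻¹ * x⁻¹ = 1 := by rw [← hx]; group
  simpa using this

theorem IsFlatGroup.isNilpotent {G : Type*} [Group G] [Finite G] (h : IsFlatGroup G) :
    Group.IsNilpotent G := by
  obtain ⟨n, hn⟩ : ∃ n, Nat.card G = n := ⟨_, rfl⟩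
  induction n using Nat.strong_induction_on generalizing G with
  | _ n ih =>
    subst hn
    refine isNilpotent_of_quotient_of_monolithic (fun N _ hN => ?_) fun hm => ?_
    · exact ih _ (card_quotient_lt hN)
        (h.of_surjective (QuotientGroup.mk' N) (QuotientGroup.mk'_surjective N)) rfl
    · have : Nontrivial G := by
        obtain ⟨M, hM, -⟩ := hm
        obtain ⟨a, ha⟩ := M.bot_or_exists_ne_one.resolve_left hM.prop.2
        exact ⟨a, 1, ha.2⟩
      exact h.center_ne_bot

/-! ### Central commutators in monolithic quotients -/

/-- Every noncentral element has a nontrivial central commutator. -/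
def HasCentralCommutators (G : Type*) [Group G] : Prop :=
  ∀ g : G, g ∉ Subgroup.center G → ∃ x : G, ⁅g, x⁆ ≠ 1 ∧ ⁅g, x⁆ ∈ Subgroup.center G

theorem hasCentralCommutators_iff {G H : Type*} [Group G] [Group H] (f : G →* H)
    (hf : Function.Surjective f) :
    HasCentralCommutators H ↔ ∀ g : G, ¬ elementCommutator g ≤ f.ker →
      ∃ x : G, ⁅g, x⁆ ∉ f.ker ∧ elementCommutator ⁅g, x⁆ ≤ f.ker := by
  simp only [HasCentralCommutators, hf.forall, hf.exists, elementCommutator_le_ker_iff f hf,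
    MonoidHom.mem_ker, map_commutatorElement, ne_eq]

/-- All monolithic quotients of `G` have central commutators. -/
def MonolithicQuotientsHaveCentralCommutators (G : Type*) [Group G] : Prop :=
  ∀ (N : Subgroup G) [N.Normal], IsMonolithic (G ⧸ N) →
    ∀ g : G, ¬ elementCommutator g ≤ N → ∃ x : G, ⁅g, x⁆ ∉ N ∧ elementCommutator ⁅g, x⁆ ≤ N

theorem MonolithicQuotientsHaveCentralCommutators.of_surjective {G H : Type*} [Group G] [Group H]
    (h : MonolithicQuotientsHaveCentralCommutators G) (f : G →* H) (hf : Function.Surjective f)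
    (hH : IsMonolithic H) : HasCentralCommutators H :=
  (hasCentralCommutators_iff f hf).mpr
    (h f.ker (hH.of_mulEquiv (QuotientGroup.quotientKerEquivOfSurjective f hf).symm))

theorem MonolithicQuotientsHaveCentralCommutators.comp {G H : Type*} [Group G] [Group H]
    (h : MonolithicQuotientsHaveCentralCommutators G) (f : G →* H) (hf : Function.Surjective f) :
    MonolithicQuotientsHaveCentralCommutators H := by
  intro N _ hN
  have := (hasCentralCommutators_iff (QuotientGroup.mk' N) (QuotientGroup.mk'_surjective N)).mp
    (h.of_surjective ((QuotientGroup.mk' N).comp f)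
      ((QuotientGroup.mk'_surjective N).comp hf) hN)
  simpa only [QuotientGroup.ker_mk'] using this

theorem MonolithicQuotientsHaveCentralCommutators.isNilpotent {G : Type*} [Group G] [Finite G]
    (h : MonolithicQuotientsHaveCentralCommutators G) : Group.IsNilpotent G := by
  obtain ⟨n, hn⟩ : ∃ n, Nat.card G = n := ⟨_, rfl⟩
  induction n using Nat.strong_induction_on generalizing G with
  | _ n ih =>
    subst hn
    refine isNilpotent_of_quotient_of_monolithic (fun N _ hN => ?_) fun hm hc => ?_
    · exact ih _ (card_quotient_lt hN)
        (h.comp (QuotientGroup.mk' N) (QuotientGroup.mk'_surjective N)) rfl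
    -- If the center were trivial, any `g ≠ 1` would be noncentral and so have a commutator that is
    -- both central and nontrivial.
    · obtain ⟨M, hM, hM'⟩ := hm
      obtain ⟨g, -, hg⟩ := M.bot_or_exists_ne_one.resolve_left hM.prop.2
      obtain ⟨x, hx, hx'⟩ := h.of_surjective (MonoidHom.id G) Function.surjective_id
        ⟨M, hM, hM'⟩ g (by simpa [hc] using hg)
      exact hx (by simpa [hc] using hx')

/-! ### Nilpotent groups with cyclic center -/

/-- Under conjugation by a `p`-group, a set of order divisible by `p` with one fixed point has
another. -/
theorem inf_center_ne_bot {G : Type*} [Group G] [Finite G] {p : ℕ} [Fact p.Prime]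
    (hG : IsPGroup p G) {M : Subgroup G} [M.Normal] (hM : M ≠ ⊥) :
    M ⊓ Subgroup.center G ≠ ⊥ := by
  have : Nontrivial M := M.nontrivial_iff_ne_bot.mpr hM
  have hp : p ∣ Nat.card M := by
    obtain ⟨n, hn, hn'⟩ := IsPGroup.nontrivial_iff_card (hG.to_subgroup M) |>.mp this
    exact hn' ▸ dvd_pow_self p hn.ne'
  have hG' : IsPGroup p (ConjAct G) := hG
  obtain ⟨a, ha, ha1⟩ := hG'.exists_fixed_point_of_prime_dvd_card_of_fixed_point M hp
    (a := (1 : M)) (by intro g; ext; simp)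
  rw [Subgroup.ne_bot_iff_exists_ne_one]
  refine ⟨⟨a, a.2, ?_⟩, fun h => ha1 (Subtype.ext (congrArg Subtype.val h).symm)⟩
  refine Subgroup.mem_center_iff.mpr fun g => ?_
  have h1 := congrArg Subtype.val (ha (ConjAct.toConjAct g))
  rw [ConjAct.Subgroup.val_conj_smul, ConjAct.smul_def] at h1
  simpa [mul_inv_eq_iff_eq_mul] using h1

/-- Every minimal normal subgroup contains a central element of order `p`, and a cyclic center has
only one subgroup of order `p`. -/
theorem IsPGroup.isMonolithic {G : Type*} [Group G] [Finite G] [Nontrivial G] {p : ℕ}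
    [Fact p.Prime] (hG : IsPGroup p G) (hc : IsCyclic (Subgroup.center G)) : IsMonolithic G := by
  have key : ∀ M : Subgroup G, Minimal (fun L : Subgroup G => L.Normal ∧ L ≠ ⊥) M →
      ∃ a : Subgroup.center G, orderOf a = p ∧ (a : G) ∈ M := by
    intro M hM
    have := hM.prop.1
    have h1 := inf_center_ne_bot hG hM.prop.2
    have : Nontrivial ↥(M ⊓ Subgroup.center G) := (Subgroup.nontrivial_iff_ne_bot _).mpr h1
    have hp : p ∣ Nat.card ↥(M ⊓ Subgroup.center G) := by
      obtain ⟨n, hn, hn'⟩ := IsPGroup.nontrivial_iff_card (hG.to_subgroup _) |>.mp this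
      exact hn' ▸ dvd_pow_self p hn.ne'
    obtain ⟨a, ha⟩ := exists_prime_orderOf_dvd_card' p hp
    refine ⟨⟨a, a.2.2⟩, ?_, a.2.1⟩
    rw [← Subgroup.orderOf_coe] at ha ⊢
    exact ha
  obtain ⟨M, -, hM⟩ := exists_minimal_normal_le (G := G) (K := ⊤) inferInstance top_ne_bot
  refine ⟨M, hM, fun L hL => ?_⟩
  obtain ⟨a, ha, haM⟩ := key M hM
  obtain ⟨b, hb, hbL⟩ := key L hL
  have hab : b ∈ Subgroup.zpowers a := by
    classical
    have := Fintype.ofFinite (Subgroup.center G)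
    have hp : 0 < p := (Fact.out : p.Prime).pos
    -- A cyclic group has at most `p` solutions of `x ^ p = 1`; the powers of `a` already account
    -- for `p` of them.
    have h1 := IsCyclic.card_pow_eq_one_le (α := Subgroup.center G) hp
    have h2 : (Subgroup.zpowers a : Set (Subgroup.center G)).toFinset ⊆
        Finset.univ.filter (fun x => x ^ p = 1) := by
      intro x hx
      obtain ⟨k, rfl⟩ : ∃ k : ℤ, a ^ k = x := by simpa [Subgroup.mem_zpowers_iff] using hx
      rw [Finset.mem_filter_univ, ← zpow_natCast, zpow_comm, zpow_natCast, ← ha,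
        pow_orderOf_eq_one, one_zpow]
    have h3 := Finset.eq_of_subset_of_card_le h2 (h1.trans (by
      rw [Set.toFinset_card, ← Nat.card_eq_fintype_card]
      exact (ha ▸ Nat.card_zpowers a).ge))
    have h4 : b ∈ (Subgroup.zpowers a : Set (Subgroup.center G)).toFinset := by
      rw [h3]; simp [← hb, pow_orderOf_eq_one]
    simpa using h4
  have hbM : (b : G) ∈ M := by
    obtain ⟨k, rfl⟩ := Subgroup.mem_zpowers_iff.mp hab
    exact M.zpow_mem haM k
  have hb1 : (b : G) ≠ 1 := by
    intro h
    have : b = 1 := Subtype.ext h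
    rw [this, orderOf_one] at hb
    exact (Fact.out : p.Prime).one_lt.ne hb
  have hne : M ⊓ L ≠ ⊥ := fun h => hb1 (Subgroup.mem_bot.mp (h ▸ ⟨hbM, hbL⟩))
  exact le_antisymm (minimal_normal_le_of_inf_ne_bot hL hM.prop.1 (by rwa [inf_comm]))
    (minimal_normal_le_of_inf_ne_bot hM hL.prop.1 hne)

theorem mulSingle_mem_center {ι : Type*} [DecidableEq ι] {A : ι → Type*} [∀ i, Group (A i)]
    {i : ι} {a : A i} (ha : a ∈ Subgroup.center (A i)) :
    (Pi.mulSingle i a : ∀ i, A i) ∈ Subgroup.center (∀ i, A i) := by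
  rw [Subgroup.mem_center_iff] at ha ⊢
  intro g
  ext j
  by_cases h : j = i
  · subst h; simp [ha]
  · simp [h]

/-- A direct product of `p`-groups whose monolithic quotients have central commutators has
central commutators if its center is cyclic. -/
theorem hasCentralCommutators_pi {ι : Type*} {A : ι → Type*} [∀ i, Group (A i)]
    [∀ i, Finite (A i)] {p : ι → ℕ} (hp : ∀ i, (p i).Prime) (hA : ∀ i, IsPGroup (p i) (A i))
    (hc : IsCyclic (Subgroup.center (∀ i, A i)))
    (h : MonolithicQuotientsHaveCentralCommutators (∀ i, A i)) :
    HasCentralCommutators (∀ i, A i) := by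
  classical
  intro g hg
  obtain ⟨i, hi⟩ : ∃ i, g i ∉ Subgroup.center (A i) := by
    by_contra! hall
    exact hg (Subgroup.mem_center_iff.mpr fun x => funext fun i =>
      Subgroup.mem_center_iff.mp (hall i) (x i))
  have : Fact (p i).Prime := ⟨hp i⟩
  have : Nontrivial (A i) := by
    by_contra hn
    rw [not_nontrivial_iff_subsingleton] at hn
    exact hi (Subsingleton.elim (1 : A i) (g i) ▸ one_mem _)
  have hci : IsCyclic (Subgroup.center (A i)) := by
    refine isCyclic_of_injective
      (((MonoidHom.mulSingle A i).comp (Subgroup.center (A i)).subtype).codRestrict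
        (Subgroup.center (∀ i, A i)) fun a => mulSingle_mem_center a.2) ?_
    intro a b hab
    have h1 : (Pi.mulSingle i (a : A i) : ∀ i, A i) = Pi.mulSingle i (b : A i) :=
      congrArg Subtype.val hab
    exact Subtype.ext (Pi.mulSingle_injective i h1)
  obtain ⟨x, hx, hx'⟩ := h.of_surjective (Pi.evalMonoidHom A i) (Function.surjective_eval i)
    ((hA i).isMonolithic hci) (g i) hi
  -- An element supported at `i` only interacts with the coordinate `g i`.
  have h1 : ⁅g, Pi.mulSingle i x⁆ = Pi.mulSingle i ⁅g i, x⁆ := by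
    ext j
    by_cases hj : j = i
    · subst hj; simp [commutatorElement_def]
    · simp [commutatorElement_def, hj]
  refine ⟨Pi.mulSingle i x, ?_, ?_⟩
  · rw [h1]; simpa using hx
  · rw [h1]; exact mulSingle_mem_center hx'

theorem HasCentralCommutators.of_mulEquiv {G H : Type*} [Group G] [Group H]
    (h : HasCentralCommutators G) (e : G ≃* H) : HasCentralCommutators H := by
  refine (hasCentralCommutators_iff e.toMonoidHom e.surjective).mpr fun g hg => ?_
  have h1 := (hasCentralCommutators_iff (MonoidHom.id G) Function.surjective_id).mp h
  have h2 : (MonoidHom.id G).ker = e.toMonoidHom.ker := by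
    rw [(MonoidHom.ker_eq_bot_iff e.toMonoidHom).mpr e.injective,
      (MonoidHom.ker_eq_bot_iff (MonoidHom.id G)).mpr Function.injective_id]
  rw [h2] at h1
  exact h1 g hg

theorem MonolithicQuotientsHaveCentralCommutators.of_isCyclic_center {G : Type*} [Group G]
    [Finite G] [Group.IsNilpotent G] (h : MonolithicQuotientsHaveCentralCommutators G)
    (hc : IsCyclic (Subgroup.center G)) : HasCentralCommutators G := by
  let e : (∀ p : (Nat.card G).primeFactors, ∀ P : Sylow p G, P) ≃* G :=
    Sylow.directProductOfNormal fun _ => inferInstance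
  -- The nested product over primes and their Sylow subgroups is flattened to a single index.
  let e' : (∀ i : (Σ p : (Nat.card G).primeFactors, Sylow p G), i.2) ≃* G :=
    { (Equiv.piCurry fun (p : (Nat.card G).primeFactors) (P : Sylow p G) => P).trans
        e.toEquiv with
      map_mul' := fun a b => e.map_mul (Sigma.curry a) (Sigma.curry b) }
  refine (hasCentralCommutators_pi (p := fun i => (i.1 : ℕ))
    (fun i => Nat.prime_of_mem_primeFactors i.1.2) (fun i => i.2.isPGroup') ?_
    (h.comp e'.symm.toMonoidHom e'.symm.surjective)).of_mulEquiv e'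
  exact isCyclic_of_injective (Subgroup.centerCongr e').toMonoidHom
    (Subgroup.centerCongr e').injective

theorem IsFlatGroup.hasCentralCommutators {G : Type*} [Group G] [Finite G] (h : IsFlatGroup G)
    (hG : IsMonolithic G) : HasCentralCommutators G := by
  intro g hg
  obtain ⟨M, hMn, hM, hle⟩ := hG.exists_le
  obtain ⟨a, haM, ha⟩ := M.bot_or_exists_ne_one.resolve_left hM
  have : Nontrivial G := ⟨a, 1, ha⟩
  have hne : elementCommutator g ≠ ⊥ := fun h0 =>
    hg (mem_center_iff_commutatorElement_eq_one.mpr fun x => by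
      simpa [h0] using commutatorElement_mem_elementCommutator g x)
  obtain ⟨x, rfl⟩ := h g a (hle _ inferInstance hne haM)
  exact ⟨x, ha, hle _ inferInstance h.center_ne_bot haM⟩

/-! ### Irreducible representations, kernels and centers of characters -/

theorem Representation.isIrreducible_iff_forall_submodule {k G V : Type*} [Monoid G] [Field k]
    [AddCommGroup V] [Module k V] {ρ : Representation k G V} :
    ρ.IsIrreducible ↔ Nontrivial V ∧
      ∀ W : Submodule k V, (∀ g, ∀ v ∈ W, ρ g v ∈ W) → W = ⊥ ∨ W = ⊤ := by
  constructor
  · intro h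
    refine ⟨?_, fun W hW => ?_⟩
    · by_contra hV
      rw [not_nontrivial_iff_subsingleton] at hV
      exact bot_ne_top (α := Subrepresentation ρ)
        (Subrepresentation.toSubmodule_injective (Subsingleton.elim _ _))
    · exact (eq_bot_or_eq_top (⟨W, hW⟩ : Subrepresentation ρ)).imp
        (congrArg Subrepresentation.toSubmodule) (congrArg Subrepresentation.toSubmodule)
  · rintro ⟨hV, h⟩
    have : Nontrivial (Subrepresentation ρ) :=
      ⟨⊥, ⊤, fun h => bot_ne_top (α := Submodule k V) (congrArg Subrepresentation.toSubmodule h)⟩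
    exact ⟨fun W => (h W.toSubmodule W.apply_mem_toSubmodule).imp
      (fun h => Subrepresentation.toSubmodule_injective h)
      (fun h => Subrepresentation.toSubmodule_injective h)⟩

theorem Representation.isIrreducible_comp_iff {k G H V : Type*} [Monoid G] [Monoid H] [Field k]
    [AddCommGroup V] [Module k V] (ρ : Representation k H V) (f : G →* H)
    (hf : Function.Surjective f) :
    Representation.IsIrreducible (ρ.comp f : Representation k G V) ↔ ρ.IsIrreducible := by
  simp only [Representation.isIrreducible_iff_forall_submodule, hf.forall, MonoidHom.comp_apply]

/-- Schur's lemma. -/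
theorem Representation.IsIrreducible.exists_eq_smul_one {k G V : Type*} [Monoid G] [Field k]
    [IsAlgClosed k] [AddCommGroup V] [Module k V] [FiniteDimensional k V]
    {ρ : Representation k G V} (hρ : ρ.IsIrreducible) (f : Module.End k V)
    (hf : ∀ g, Commute f (ρ g)) : ∃ c : k, f = c • 1 := by
  obtain ⟨hV, h⟩ := Representation.isIrreducible_iff_forall_submodule.mp hρ
  obtain ⟨c, hc⟩ := Module.End.exists_eigenvalue f
  refine ⟨c, ?_⟩
  have h1 : f.eigenspace c = ⊤ := (h _ fun g v hv => by
    rw [Module.End.mem_eigenspace_iff] at hv ⊢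
    have := LinearMap.congr_fun (hf g).eq v
    simp only [Module.End.mul_apply] at this
    rw [this, hv, map_smul]).resolve_left hc
  ext v
  have h2 : v ∈ f.eigenspace c := h1 ▸ Submodule.mem_top
  simpa using Module.End.mem_eigenspace_iff.mp h2

open scoped MonoidAlgebra in
/-- An element of the group algebra killed by all irreducible representations is zero. -/
theorem eq_zero_of_forall_isIrreducible {G : Type*} [Group G] [Finite G] (a : ℂ[G])
    (ha : ∀ (n : ℕ) (ρ : Representation ℂ G (Fin n → ℂ)), ρ.IsIrreducible →
      ρ.asAlgebraHom a = 0) : a = 0 := by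
  have : Module.Finite ℂ ℂ[G] := inferInstance
  -- The algebra is semisimple by Maschke, so its radical is zero. Since `a` kills the simple module
  -- `ℂ[G] ⧸ m`, it kills the class of `1`, whence `a ∈ m`.
  have hj : a ∈ Ring.jacobson ℂ[G] := by
    rw [Ring.jacobson, Module.jacobson, Submodule.mem_sInf]
    intro m hm
    have hs : IsSimpleModule ℂ[G] (ℂ[G] ⧸ m) := isSimpleModule_iff_isCoatom.mpr hm
    let e := (Module.finBasis ℂ (ℂ[G] ⧸ m)).equivFun
    let φ : ℂ[G] →ₐ[ℂ] Module.End ℂ (Fin _ → ℂ) :=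
      (e.conjAlgEquiv ℂ).toAlgHom.comp (Algebra.lsmul ℂ ℂ (ℂ[G] ⧸ m))
    have hφ : ∀ b v, φ b v = e (b • e.symm v) := fun _ _ => rfl
    let ρ : Representation ℂ G (Fin _ → ℂ) := (MonoidAlgebra.lift ℂ _ G).symm φ
    have hρφ : ρ.asAlgebraHom = φ := (MonoidAlgebra.lift ℂ _ G).apply_symm_apply φ
    have hρ : ρ.IsIrreducible := by
      rw [Representation.isIrreducible_iff_forall_submodule]
      have := IsSimpleModule.nontrivial ℂ[G] (ℂ[G] ⧸ m)
      refine ⟨e.symm.toEquiv.nontrivial, fun W hW => ?_⟩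
      have hW' : ∀ b : ℂ[G], ∀ v ∈ W, φ b v ∈ W := by
        intro b v hv
        rw [← hρφ]
        induction b using MonoidAlgebra.induction_on with
        | of g => simpa using hW g v hv
        | add x y hx hy => simpa using W.add_mem hx hy
        | smul r x hx => simpa using W.smul_mem r hx
      let W' : Submodule ℂ[G] (ℂ[G] ⧸ m) :=
        { carrier := {v | e v ∈ W}
          add_mem' := fun {x y} hx hy => by
            change e (x + y) ∈ W
            rw [map_add]; exact W.add_mem hx hy
          zero_mem' := by
            change e 0 ∈ W
            rw [map_zero]; exact W.zero_mem
          smul_mem' := fun b x hx => by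
            have := hW' b _ hx
            rwa [hφ, e.symm_apply_apply] at this }
      have hmem : ∀ v, v ∈ W ↔ e.symm v ∈ W' := by
        intro v
        change _ ↔ e (e.symm v) ∈ W
        rw [e.apply_symm_apply]
      refine (eq_bot_or_eq_top W').imp (fun h => ?_) fun h => ?_
      · ext v; simp [hmem, h]
      · ext v; simp [hmem, h]
    have h0 := ha _ ρ hρ
    rw [hρφ] at h0
    have h1 := LinearMap.congr_fun h0 (e (Submodule.Quotient.mk 1))
    rw [hφ, e.symm_apply_apply, LinearMap.zero_apply, map_eq_zero_iff e e.injective,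
      ← Submodule.Quotient.mk_smul, Submodule.Quotient.mk_eq_zero, smul_eq_mul, mul_one] at h1
    exact h1
  rwa [IsSemisimpleRing.jacobson_eq_bot, Submodule.mem_bot] at hj

/-- An endomorphism of finite order whose trace has norm the dimension is scalar. -/
theorem end_eq_smul_one_of_pow_eq_one_of_norm_trace {V : Type*} [AddCommGroup V] [Module ℂ V]
    [FiniteDimensional ℂ V] [Nontrivial V] (f : Module.End ℂ V) {m : ℕ} (hm : m ≠ 0)
    (hf : f ^ m = 1) (ht : ‖LinearMap.trace ℂ V f‖ = Module.finrank ℂ V) :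
    ∃ c : ℂ, f = c • 1 := by
  have hss : f.IsSemisimple := by
    refine Module.End.isSemisimple_of_squarefree_aeval_eq_zero
      (p := (Polynomial.X ^ m - 1 : Polynomial ℂ)) ?_ (by simp [hf])
    exact (Polynomial.X_pow_sub_one_separable_iff.mpr (by exact_mod_cast hm)).squarefree
  have hnorm : ∀ μ : ℂ, f.HasEigenvalue μ → ‖μ‖ = 1 := by
    intro μ hμ
    obtain ⟨v, hv⟩ := hμ.exists_hasEigenvector
    have h1 := hv.pow_apply m
    rw [hf] at h1
    have h2 : (μ ^ m - 1) • v = 0 := by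
      rw [sub_smul, ← h1]; simp
    exact Complex.norm_eq_one_of_pow_eq_one
      (sub_eq_zero.mp ((smul_eq_zero.mp h2).resolve_right hv.2)) hm
  have hn : (Module.finrank ℂ V : ℝ) ≠ 0 := by exact_mod_cast Module.finrank_pos.ne'
  -- `ν` is the inverse phase of the trace: after rotation by `ν`, unit eigenvalues sum to the
  -- dimension, so each rotated eigenvalue is `1`.
  obtain ⟨ν, hν, hνt⟩ : ∃ ν : ℂ, ‖ν‖ = 1 ∧
      ν * LinearMap.trace ℂ V f = (Module.finrank ℂ V : ℝ) := by
    refine ⟨(starRingEnd ℂ) (LinearMap.trace ℂ V f) / (Module.finrank ℂ V : ℝ), ?_, ?_⟩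
    · rw [norm_div, RCLike.norm_conj, ht, Complex.norm_real, Real.norm_natCast, div_self hn]
    · rw [div_mul_eq_mul_div, mul_comm, Complex.mul_conj, Complex.normSq_eq_norm_sq, ht]
      rw [div_eq_iff (by exact_mod_cast hn)]
      push_cast; ring
  have hmem : ∀ μ ∈ f.charpoly.roots, f.HasEigenvalue μ := fun μ hμ =>
    (Module.End.hasEigenvalue_iff_isRoot_charpoly f μ).mpr (Polynomial.isRoot_of_mem_roots hμ)
  have hle : ∀ μ ∈ f.charpoly.roots, 0 ≤ 1 - (ν * μ).re := by
    intro μ hμ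
    have := Complex.re_le_norm (ν * μ)
    rw [norm_mul, hν, hnorm μ (hmem μ hμ)] at this
    linarith
  have hone : ∀ μ ∈ f.charpoly.roots, ν * μ = 1 := by
    have hsum : (f.charpoly.roots.map fun μ => 1 - (ν * μ).re).sum = 0 := by
      have h1 : (f.charpoly.roots.map fun μ => (ν * μ).re).sum =
          (f.charpoly.roots.map fun μ => ν * μ).sum.re := by
        rw [← Complex.coe_reAddGroupHom, map_multiset_sum, Multiset.map_map]
        rfl
      have hcard : f.charpoly.roots.card = Module.finrank ℂ V := by
        rw [IsAlgClosed.card_roots_eq_natDegree, LinearMap.charpoly_natDegree]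
      rw [Multiset.sum_map_sub, h1, Multiset.sum_map_mul_left, Multiset.map_id',
        ← Module.End.trace_eq_sum_roots_charpoly_of_splits (IsAlgClosed.splits _), hνt]
      simp [hcard]
    have h0 := Multiset.all_zero_of_le_zero_le_of_sum_eq_zero (s := f.charpoly.roots.map _)
      (by
        intro x hx
        obtain ⟨μ, hμ, rfl⟩ := Multiset.mem_map.mp hx
        exact hle μ hμ) hsum
    intro μ hμ
    have h3 : (ν * μ).re = 1 := by
      have := h0 _ (Multiset.mem_map_of_mem _ hμ)
      linarith
    have h4 := Complex.sq_norm (ν * μ)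
    rw [norm_mul, hν, hnorm μ (hmem μ hμ), Complex.normSq_apply, h3] at h4
    have h5 : (ν * μ).im = 0 := by nlinarith
    exact Complex.ext (by simpa using h3) (by simpa using h5)
  have htop : f.eigenspace ν⁻¹ = ⊤ := by
    rw [← hss.iSup_eigenspace_eq_top]
    refine le_antisymm (le_iSup _ ν⁻¹) (iSup_le fun μ => ?_)
    by_cases hμ : f.HasEigenvalue μ
    · rw [eq_inv_of_mul_eq_one_right (hone μ ((Polynomial.mem_roots f.charpoly_monic.ne_zero).mpr
        ((Module.End.hasEigenvalue_iff_isRoot_charpoly f μ).mp hμ)))]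
    · have : f.eigenspace μ = ⊥ := by
        simpa [Module.End.hasEigenvalue_iff] using hμ
      simp [this]
  refine ⟨ν⁻¹, LinearMap.ext fun v => ?_⟩
  have : v ∈ f.eigenspace ν⁻¹ := htop ▸ Submodule.mem_top
  simpa using Module.End.mem_eigenspace_iff.mp this

section Character

variable {G : Type*} [Group G] [Finite G] {n : ℕ} {ρ : Representation ℂ G (Fin n → ℂ)}

theorem mem_charKernel_iff (hχ : ρ.character ∈ Irr G) {g : G} :
    g ∈ charKernel hχ ↔ ρ g = 1 :=
  character_eq_character_one_iff ρ g

theorem Representation.IsIrreducible.mem_charCenter_iff_exists (hρ : ρ.IsIrreducible) {g : G} :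
    g ∈ charCenter ρ.character ↔ ∃ c : ℂ, ρ g = c • 1 := by
  have := (Representation.isIrreducible_iff_forall_submodule.mp hρ).1
  have hpow : ρ g ^ orderOf g = 1 := by rw [← map_pow, pow_orderOf_eq_one, map_one]
  change (‖ρ.character g‖ : ℂ) = ρ.character 1 ↔ _
  rw [Representation.char_one]
  constructor
  · intro h
    exact end_eq_smul_one_of_pow_eq_one_of_norm_trace (ρ g) (orderOf_pos g).ne' hpow
      (by exact_mod_cast h)
  · rintro ⟨c, hc⟩
    have hc1 : c ^ orderOf g = 1 := by
      rw [hc, smul_pow, one_pow] at hpow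
      exact smul_left_injective ℂ (one_ne_zero (α := Module.End ℂ (Fin n → ℂ)))
        (by simpa using hpow)
    rw [Representation.character, hc, map_smul, LinearMap.trace_one, smul_eq_mul, norm_mul,
      Complex.norm_eq_one_of_pow_eq_one hc1 (orderOf_pos g).ne']
    simp

theorem Representation.IsIrreducible.mem_charCenter_iff (hρ : ρ.IsIrreducible)
    (hχ : ρ.character ∈ Irr G) {g : G} :
    g ∈ charCenter ρ.character ↔ elementCommutator g ≤ charKernel hχ := by
  rw [elementCommutator_le_iff, hρ.mem_charCenter_iff_exists]
  simp only [mem_charKernel_iff]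
  constructor
  · rintro ⟨c, hc⟩ x
    have h : ρ (g * x) = ρ (x * g) := by simp [map_mul, hc]
    rw [show ⁅g, x⁆ = g * x * (x * g)⁻¹ by rw [commutatorElement_def]; group, map_mul, h,
      ← map_mul, mul_inv_cancel, map_one]
  · intro h
    refine hρ.exists_eq_smul_one _ fun x => (?_ : ρ g * ρ x = ρ x * ρ g)
    have h1 : ρ (⁅g, x⁆ * (x * g)) = ρ (x * g) := by rw [map_mul, h x, one_mul]
    rw [show ⁅g, x⁆ * (x * g) = g * x by rw [commutatorElement_def]; group] at h1
    rwa [map_mul, map_mul] at h1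

end Character

/-- A character vanishes at `g` if some commutator `[g, x]` acts as a nontrivial scalar. -/
theorem Representation.IsIrreducible.character_eq_zero {G : Type*} [Group G] [Finite G] {n : ℕ}
    {ρ : Representation ℂ G (Fin n → ℂ)} (hρ : ρ.IsIrreducible) (hχ : ρ.character ∈ Irr G)
    {g x : G} (hx : ⁅g, x⁆ ∈ charCenter ρ.character) (hx' : ⁅g, x⁆ ∉ charKernel hχ) :
    ρ.character g = 0 := by
  obtain ⟨c, hc⟩ := hρ.mem_charCenter_iff_exists.mp hx
  rw [mem_charKernel_iff] at hx'
  have h1 : ρ.character g = c * ρ.character g := by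
    conv_lhs => rw [show g = ⁅g, x⁆ * (x * g * x⁻¹) by rw [commutatorElement_def]; group]
    rw [Representation.character, map_mul, hc, smul_mul_assoc, one_mul, map_smul, smul_eq_mul]
    exact congrArg _ (Representation.char_conj ρ g x)
  by_contra h0
  exact hx' (by rw [hc, (mul_eq_right₀ h0).mp h1.symm, one_smul])

/-! ### GVZ-groups are flat -/

open scoped MonoidAlgebra in
theorem IsGVZGroup.isFlatGroup {G : Type*} [Group G] [Finite G] (h : IsGVZGroup G) :
    IsFlatGroup G := by
  classical
  have := Fintype.ofFinite G
  intro g z hz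
  let H := elementCommutator g
  -- The weights give both sums the same total mass `|G| |H|`, so they agree when `ρ` sends all
  -- terms to `ρ g`.
  let a : ℂ[G] := (Fintype.card H : ℂ) • ∑ x : G, MonoidAlgebra.of ℂ G (x * g * x⁻¹) -
    (Fintype.card G : ℂ) • ∑ k : H, MonoidAlgebra.of ℂ G (k * g)
  have ha : a = 0 := by
    refine eq_zero_of_forall_isIrreducible a fun n ρ hρ => ?_
    have hχ : ρ.character ∈ Irr G := ⟨n, ρ, hρ, rfl⟩
    have hn := (Representation.isIrreducible_iff_forall_submodule.mp hρ).1
    simp only [a, map_sub, map_smul, map_sum, Representation.asAlgebraHom_of]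
    rw [sub_eq_zero]
    by_cases hg : g ∈ charCenter ρ.character
    · have hH := (hρ.mem_charCenter_iff hχ).mp hg
      have h1 : ∀ x : G, ρ (x * g * x⁻¹) = ρ g := fun x => by
        have h2 : ρ ⁅g, x⁆ = 1 :=
          (mem_charKernel_iff hχ).mp (hH (commutatorElement_mem_elementCommutator g x))
        rw [← one_mul (ρ (x * g * x⁻¹)), ← h2, ← map_mul,
          show ⁅g, x⁆ * (x * g * x⁻¹) = g by rw [commutatorElement_def]; group]
      have h2 : ∀ k : H, ρ (k * g) = ρ g := fun k => by
        rw [map_mul, (mem_charKernel_iff hχ).mp (hH k.2), one_mul]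
      simp only [h1, h2, Finset.sum_const, Finset.card_univ, ← Nat.cast_smul_eq_nsmul ℂ]
      rw [smul_comm]
    · have hχg := h _ hχ g hg
      -- The class sum is central, hence scalar, and its trace is `|G| χ(g) = 0`.
      have h1 : ∑ x : G, ρ (x * g * x⁻¹) = 0 := by
        obtain ⟨c, hc⟩ := hρ.exists_eq_smul_one (∑ x : G, ρ (x * g * x⁻¹)) fun y => by
          change _ * _ = _ * _
          rw [Finset.sum_mul, Finset.mul_sum, ← Equiv.sum_comp (Equiv.mulLeft y)]
          refine Finset.sum_congr rfl fun x _ => ?_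
          rw [← map_mul, ← map_mul]
          congr 1
          simp only [Equiv.coe_mulLeft]; group
        have h2 := congrArg (LinearMap.trace ℂ (Fin n → ℂ)) hc
        have h3 : ∀ x, LinearMap.trace ℂ (Fin n → ℂ) (ρ (x * g * x⁻¹)) = 0 := fun x =>
          (Representation.char_conj ρ g x).trans hχg
        rw [map_sum, Finset.sum_eq_zero fun x _ => h3 x, map_smul, LinearMap.trace_one,
          smul_eq_mul, eq_comm, mul_eq_zero] at h2
        rw [hc, h2.resolve_right (by exact_mod_cast Module.finrank_pos.ne'), zero_smul]
      -- The sum over the normal subgroup `H` is a scalar absorbing each `ρ k`; if nonzero, it would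
      -- put `H` inside the kernel.
      have h2 : ∑ k : H, ρ k = 0 := by
        obtain ⟨c, hc⟩ := hρ.exists_eq_smul_one (∑ k : H, ρ k) fun y => by
          change _ * _ = _ * _
          rw [Finset.sum_mul, Finset.mul_sum,
            ← Equiv.sum_comp (MulAut.conjNormal (H := H) y).toEquiv]
          refine Finset.sum_congr rfl fun x _ => ?_
          rw [← map_mul, ← map_mul]
          congr 1
          simp [MulAut.conjNormal_apply]
        by_cases hc0 : c = 0
        · rw [hc, hc0, zero_smul]
        · refine absurd ((hρ.mem_charCenter_iff hχ).mpr fun k hk => ?_) hg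
          rw [mem_charKernel_iff]
          have h3 : ρ k * ∑ k : H, ρ k = ∑ k : H, ρ k := by
            rw [Finset.mul_sum]
            conv_rhs => rw [← Equiv.sum_comp (Equiv.mulLeft (⟨k, hk⟩ : H))]
            simp
          rw [hc, mul_smul_comm, mul_one] at h3
          exact smul_right_injective _ hc0 h3
      have h3 : ∑ k : H, ρ (k * g) = 0 := by
        simp only [map_mul, ← Finset.sum_mul, h2, zero_mul]
      rw [h1, h3, smul_zero, smul_zero]
  -- `[g, x] = z` amounts to `x * g * x⁻¹ = z⁻¹ * g`. Without such an `x`, the coefficient there is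
  -- `-|G|`, not `0`.
  have hcoeff := congrArg (fun b : ℂ[G] => b.coeff (z⁻¹ * g)) ha
  by_contra! hne
  have h1 : ∀ x : G, x * g * x⁻¹ ≠ z⁻¹ * g := fun x hx => hne x (by
    rw [commutatorElement_def, show g * x * g⁻¹ * x⁻¹ = g * (x * g * x⁻¹)⁻¹ by group, hx]
    group)
  have h2 : ∀ k : H, (k : G) * g = z⁻¹ * g ↔ k = ⟨z⁻¹, inv_mem hz⟩ := fun k => by
    rw [mul_left_inj, Subtype.ext_iff]
  simp [a, MonoidAlgebra.coeff_sum, Finsupp.single_apply, h1, h2] at hcoeff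

/-! ### Faithful irreducible representations -/

theorem exists_isIrreducible_apply_ne_one {G : Type*} [Group G] [Finite G] {a : G} (ha : a ≠ 1) :
    ∃ (n : ℕ) (ρ : Representation ℂ G (Fin n → ℂ)), ρ.IsIrreducible ∧ ρ a ≠ 1 := by
  by_contra! h
  have h1 := eq_zero_of_forall_isIrreducible
    (MonoidAlgebra.of ℂ G a - MonoidAlgebra.of ℂ G 1) fun n ρ hρ => by
      rw [map_sub, Representation.asAlgebraHom_of, Representation.asAlgebraHom_of, h n ρ hρ,
        map_one, sub_self]
  exact ha (MonoidAlgebra.of_injective (sub_eq_zero.mp h1))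

/-- An irreducible representation nontrivial on the socle is faithful, since a nontrivial kernel
would contain the socle. -/
theorem IsMonolithic.exists_faithful_isIrreducible {G : Type*} [Group G] [Finite G]
    (hG : IsMonolithic G) : ∃ (n : ℕ) (ρ : Representation ℂ G (Fin n → ℂ)),
      ρ.IsIrreducible ∧ Function.Injective ρ := by
  obtain ⟨M, -, hM, hle⟩ := hG.exists_le
  obtain ⟨a, haM, ha⟩ := M.bot_or_exists_ne_one.resolve_left hM
  obtain ⟨n, ρ, hρ, hρa⟩ := exists_isIrreducible_apply_ne_one ha
  refine ⟨n, ρ, hρ, (MonoidHom.ker_eq_bot_iff (ρ : G →* _)).mp ?_⟩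
  by_contra hk
  exact hρa (hle _ inferInstance hk haM)

/-- The center of a finite group with a faithful irreducible representation is cyclic. -/
theorem Representation.IsIrreducible.isCyclic_center {G : Type*} [Group G] [Finite G] {n : ℕ}
    {ρ : Representation ℂ G (Fin n → ℂ)} (hρ : ρ.IsIrreducible) (hf : Function.Injective ρ) :
    IsCyclic (Subgroup.center G) := by
  have hn := (Representation.isIrreducible_iff_forall_submodule.mp hρ).1
  have hinj : Function.Injective fun c : ℂ => c • (1 : Module.End ℂ (Fin n → ℂ)) :=
    fun _ _ h => smul_left_injective ℂ (one_ne_zero (α := Module.End ℂ (Fin n → ℂ))) h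
  have hex : ∀ z : Subgroup.center G, ∃ c : ℂ, ρ z = c • 1 := fun z =>
    hρ.exists_eq_smul_one _ fun x => by
      change _ * _ = _ * _
      rw [← map_mul, ← map_mul, Subgroup.mem_center_iff.mp z.2 x]
  choose c hc using hex
  let f : Subgroup.center G →* ℂ :=
    { toFun := c
      map_one' := hinj (by simp [← hc])
      map_mul' := fun y z => hinj (by
        simp only [← hc, Subgroup.coe_mul, map_mul, mul_smul]
        rw [hc y, hc z, smul_mul_smul_comm, one_mul, ← mul_smul]) }
  -- Finite groups embedding in the multiplicative monoid of a field are cyclic.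
  refine isCyclic_of_injective_ringHom f fun y z hyz => Subtype.ext (hf ?_)
  rw [hc, hc]
  exact congrArg (· • _) hyz

/-! ### The equivalence -/

theorem mainTheorem1 {G : Type*} [Group G] [Finite G] (hG : ∃ a b : G, a * b ≠ b * a) :
    List.TFAE [
      IsGVZGroup G,
      ∀ (χ : G → ℂ) (hχ : χ ∈ Irr G), IsMonolithicCharacter hχ →
        ∀ g : G, g ∉ charCenter χ →
          ∃ x : G, ⁅g, x⁆ ∈ charCenter χ ∧ ⁅g, x⁆ ∉ charKernel hχ,
      Group.IsNilpotent G ∧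
        ∀ (N : Subgroup G) [N.Normal], IsMonolithic (G ⧸ N) →
          ∀ g : G, ¬ elementCommutator g ≤ N →
            ∃ x : G, ⁅g, x⁆ ∉ N ∧ elementCommutator ⁅g, x⁆ ≤ N] := by
  tfae_have 1 → 3 := fun h => by
    refine ⟨h.isFlatGroup.isNilpotent, fun N _ hN => ?_⟩
    have := (hasCentralCommutators_iff (QuotientGroup.mk' N) (QuotientGroup.mk'_surjective N)).mp
      ((h.isFlatGroup.of_surjective _ (QuotientGroup.mk'_surjective N)).hasCentralCommutators hN)
    simpa only [QuotientGroup.ker_mk'] using this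
  tfae_have 3 → 2 := by
    rintro ⟨-, h⟩ χ hχ hm g hg
    obtain ⟨n, ρ, hρ, rfl⟩ := id hχ
    rw [hρ.mem_charCenter_iff hχ] at hg
    obtain ⟨x, hx, hx'⟩ := h _ hm g hg
    exact ⟨x, (hρ.mem_charCenter_iff hχ).mpr hx', hx⟩
  tfae_have 2 → 3 := by
    intro h
    have h' : MonolithicQuotientsHaveCentralCommutators G := by
      intro N _ hN g hg
      obtain ⟨n, ρ, hρ, hf⟩ := hN.exists_faithful_isIrreducible
      let σ : Representation ℂ G (Fin n → ℂ) := ρ.comp (QuotientGroup.mk' N)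
      have hσ : σ.IsIrreducible :=
        (ρ.isIrreducible_comp_iff _ (QuotientGroup.mk'_surjective N)).mpr hρ
      have hχ : σ.character ∈ Irr G := ⟨n, σ, hσ, rfl⟩
      have hker : charKernel hχ = N := by
        ext x
        rw [mem_charKernel_iff, ← map_one σ]
        change ρ (x : G ⧸ N) = ρ ((1 : G) : G ⧸ N) ↔ _
        rw [hf.eq_iff, QuotientGroup.mk_one, QuotientGroup.eq_one_iff]
      obtain ⟨x, hx, hx'⟩ := h _ hχ
        (hN.of_mulEquiv (QuotientGroup.quotientMulEquivOfEq hker.symm)) g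
        ((hσ.mem_charCenter_iff hχ).not.mpr (hker ▸ hg))
      exact ⟨x, hker ▸ hx', hker ▸ (hσ.mem_charCenter_iff hχ).mp hx⟩
    exact ⟨h'.isNilpotent, h'⟩
  tfae_have 3 → 1 := by
    rintro ⟨hnil, h⟩ χ hχ g hg
    obtain ⟨n, ρ, hρ, rfl⟩ := id hχ
    let K := charKernel hχ
    let σ : Representation ℂ (G ⧸ K) (Fin n → ℂ) :=
      QuotientGroup.lift K ρ fun x hx => (mem_charKernel_iff hχ).mp hx
    have hσ : σ.IsIrreducible :=
      (σ.isIrreducible_comp_iff _ (QuotientGroup.mk'_surjective K)).mp hρ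
    have hf : Function.Injective σ := by
      refine (MonoidHom.ker_eq_bot_iff (σ : G ⧸ K →* _)).mp ((Subgroup.eq_bot_iff_forall _).mpr ?_)
      intro x
      induction x using QuotientGroup.induction_on with
      | H x =>
        intro hx
        exact (QuotientGroup.eq_one_iff x).mpr ((mem_charKernel_iff hχ).mpr hx)
    have h' : MonolithicQuotientsHaveCentralCommutators G := h
    -- The faithful `σ` makes the center of `G ⧸ K` cyclic, which replaces monolithicity here.
    have hK := (hasCentralCommutators_iff (QuotientGroup.mk' K)
      (QuotientGroup.mk'_surjective K)).mp
      ((h'.comp _ (QuotientGroup.mk'_surjective K)).of_isCyclic_center (hσ.isCyclic_center hf))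
    rw [QuotientGroup.ker_mk'] at hK
    obtain ⟨x, hx, hx'⟩ := hK g ((hρ.mem_charCenter_iff hχ).not.mp hg)
    exact hρ.character_eq_zero hχ ((hρ.mem_charCenter_iff hχ).mpr hx') hx
  tfae_finish
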